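/- Let $d\ge 2$, $N\ge 1$, $\mathcal H=\mathbb C^d$. For a unitary $U$ on $\mathcal H$ let $\mathcal C_{1,U}(\rho)=U\rho U^\dagger\otimes I/d$ and $\mathcal C_{2,U}(\rho)=I/d\otimes U\rho U^\dagger$. A simple parallel strategy (no reference system) consists of a density operator $\rho$ on $\mathcal H^{\otimes N}$ and a two-outcome measurement (POVM) $\{P_1,P_2\}$ on the $N$ output pairs; its error probability is $$p_{\rm err}(U_1,U_2)=\tfrac12\operatorname{Tr}[P_1\,\mathcal C_{2,U_2}^{\otimes N}(\rho)]+\tfrac12\operatorname{Tr}[P_2\,\mathcal C_{1,U_1}^{\otimes N}(\rho)],$$ and its worst-case error over a set $\mathsf V$ of unitaries is $p_{\rm err}^{\rm wc}(\mathsf V)=\sup_{U_1,U_2\in\mathsf V}p_{\rm err}(U_1,U_2)$. Let $\mathsf U$ be a finite generalised $N$-design: there is a compact group $\mathsf G$ with a continuous unitary representation $g\mapsto U_g$ on $\mathcal H$ such that $\mathsf U\subseteq\{U_g\}_{g\in\mathsf G}$ and, for every operator $A$ on $\mathcal H^{\otimes N}$, $\frac1{|\mathsf U|}\sum_{U\in\mathsf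 U}U^{\otimes N}AU^{\otimes N\dagger}=\int_{\mathsf G}U_g^{\otimes N}AU_g^{\otimes N\dagger}\,dg$, where $dg$ is the normalised invariant measure. For a unit vector $|\Psi\rangle\in\mathcal H^{\otimes N}$ put $\Psi_U=U^{\otimes N}|\Psi\rangle\langle\Psi|U^{\otimes N\dagger}$, $\langle\Psi\rangle=\frac1{|\mathsf U|}\sum_{U\in\mathsf U}\Psi_U$, and let $p_{\rm guess}$ be the supremum, over all POVMs $\{P_U\}_{U\in\mathsf U}$ on $\mathcal H^{\otimes N}$, of $\frac1{|\mathsf U|}\sum_{U\in\mathsf U}\operatorname{Tr}[P_U\Psi_U]$. Then: 1. (Complementarity) For every unit vector $|\Psi\rangle$, used as the input state $\rho=|\Psi\rangle\langle\Psi|$, and every measurement $\{P_1,P_2\}$, $$p_{\rm err}^{\rm wc}(\mathsf U)\;\ge\;\frac1{2d^N}\left\{1+\frac1{2(d^N-1)}\left(\frac{p_{\rm guess}-\frac1{|\mathsf U|}}{\frac1{|\mathsf U|}}\right)^2\right\}.$$ 2. (Guessing bound) For every unit vector $|\Psi\rangle$, every POVM $\{P_U\}_{U\in\mathsf U}$ has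 success probability at most $(\operatorname{Tr}\sqrt{\langle\Psi\rangle})^2/|\mathsf U|$. The bound is attained by the square-root measurement $P_U=\langle\Psi\rangle^{-1/2}\Psi_U\langle\Psi\rangle^{-1/2}/|\mathsf U|$ (inverse taken on the support of $\langle\Psi\rangle$), for which $P_U\ge0$ and $\sum_UP_U\le I$; hence $p_{\rm guess}=(\operatorname{Tr}\sqrt{\langle\Psi\rangle})^2/|\mathsf U|$. 3. (Optimality) For every density operator $\rho$ on $\mathcal H^{\otimes N}$, every measurement $\{P_1,P_2\}$ and every non-empty set $\mathsf V$ of unitaries on $\mathcal H$, $p_{\rm err}^{\rm wc}(\mathsf V)\ge\frac1{2d^N}$. 4. For a unit vector $|\Psi\rangle$, some measurement $\{P_1,P_2\}$ gives $p_{\rm err}^{\rm wc}(\mathsf U)=\frac1{2d^N}$ with input $|\Psi\rangle\langle\Psi|$ if and only if $p_{\rm guess}=\frac1{|\mathsf U|}$. 5. (Singlet strategy) Let $|S_d\rangle=\frac1{\sqrt{d!}}\sum_{k_1,\dots,k_d}\epsilon_{k_1\cdots k_d}|k_1\rangle\cdots|k_d\rangle$ with $\epsilon$ the totally antisymmetric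 tensor. For every $t\ge1$, $|S_d\rangle^{\otimes t}$ is a unit vector, and there is a measurement on the outputs of $td$ uses with which this input has $p_{\rm err}(U_1,U_2)=\frac1{2d^{td}}$ for all unitaries $U_1,U_2$; so its worst-case error over all unitaries is $\frac1{2d^{td}}$. -/

import Mathlib

open MeasureTheory
open scoped Kronecker Nat ComplexOrder

noncomputable section

namespace CausalIntermediary

/-! ### `N`-fold tensor powers, in the product basis

The computational basis of `N` systems of dimension `d` is indexed by `Fin N → Fin d`. -/

/-- `U^{⊗N}`. -/
def tensorPow {d : ℕ} (N : ℕ) (U : Matrix (Fin d) (Fin d) ℂ) :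
    Matrix (Fin N → Fin d) (Fin N → Fin d) ℂ :=
  Matrix.of fun i j => ∏ k, U (i k) (j k)

/-- `Φ^{⊗N}` for a linear map `Φ` between matrix spaces: the linear map that sends
`E_{i₁j₁} ⊗ ⋯ ⊗ E_{i_N j_N}` (matrix units) to `Φ(E_{i₁j₁}) ⊗ ⋯ ⊗ Φ(E_{i_N j_N})`. -/
def tensorPowMap {α β : Type} [Fintype α] [DecidableEq α] (N : ℕ)
    (Φ : Matrix α α ℂ →ₗ[ℂ] Matrix β β ℂ) :
    Matrix (Fin N → α) (Fin N → α) ℂ →ₗ[ℂ] Matrix (Fin N → β) (Fin N → β) ℂ where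
  toFun X := Matrix.of fun p q =>
    ∑ i, ∑ j, X i j * ∏ k, Φ (Matrix.single (i k) (j k) 1) (p k) (q k)
  map_add' X Y := by
    ext p q
    simp [add_mul, Finset.sum_add_distrib]
  map_smul' c X := by
    ext p q
    simp [Finset.mul_sum, mul_assoc]

/-! ### The two causal hypotheses -/

/-- `C_{1,U}(ρ) = UρU† ⊗ I/d`: `B` is a unitary image of `A`, and `C` is maximally mixed.
The output index is the pair (index of `B`, index of `C`). -/
def channelOne {d : ℕ} (U : Matrix.unitaryGroup (Fin d) ℂ) :
    Matrix (Fin d) (Fin d) ℂ →ₗ[ℂ] Matrix (Fin d × Fin d) (Fin d × Fin d) ℂ where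
  toFun ρ := ((U : Matrix (Fin d) (Fin d) ℂ) * ρ * (U : Matrix (Fin d) (Fin d) ℂ).conjTranspose)
    ⊗ₖ ((d : ℂ)⁻¹ • (1 : Matrix (Fin d) (Fin d) ℂ))
  map_add' X Y := by simp [mul_add, add_mul, Matrix.add_kronecker]
  map_smul' c X := by simp [Matrix.smul_kronecker]

/-- `C_{2,U}(ρ) = I/d ⊗ UρU†`: `C` is a unitary image of `A`, and `B` is maximally mixed. -/
def channelTwo {d : ℕ} (U : Matrix.unitaryGroup (Fin d) ℂ) :
    Matrix (Fin d) (Fin d) ℂ →ₗ[ℂ] Matrix (Fin d × Fin d) (Fin d × Fin d) ℂ where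
  toFun ρ := ((d : ℂ)⁻¹ • (1 : Matrix (Fin d) (Fin d) ℂ))
    ⊗ₖ ((U : Matrix (Fin d) (Fin d) ℂ) * ρ * (U : Matrix (Fin d) (Fin d) ℂ).conjTranspose)
  map_add' X Y := by simp [mul_add, add_mul, Matrix.kronecker_add]
  map_smul' c X := by simp [Matrix.kronecker_smul]

/-! ### States and measurements -/

/-- A density matrix. -/
structure IsDensity {κ : Type*} [Fintype κ] (ρ : Matrix κ κ ℂ) : Prop where
  posSemidef : ρ.PosSemidef
  trace_eq_one : ρ.trace = 1

/-- A quantum measurement (POVM) with outcomes in `ι`. -/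
structure IsPOVM {ι κ : Type*} [Fintype ι] [Fintype κ] [DecidableEq κ]
    (P : ι → Matrix κ κ ℂ) : Prop where
  posSemidef : ∀ x, (P x).PosSemidef
  sum_eq_one : ∑ x, P x = 1

/-- The operator `Ψ = |Ψ⟩⟨Ψ|`. -/
def pureState {κ : Type*} (ψ : EuclideanSpace ℂ κ) : Matrix κ κ ℂ :=
  Matrix.of fun i j => ψ i * star (ψ j)

/-- `p_err(U₁, U₂) = ½ Tr[P₁ C_{2,U₂}^{⊗N}(ρ)] + ½ Tr[P₂ C_{1,U₁}^{⊗N}(ρ)]`, for the input state `ρ`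
of the `N` probes and the two-outcome measurement `(P 0, P 1) = (P₁, P₂)`. -/
def errorProb {d N : ℕ} (ρ : Matrix (Fin N → Fin d) (Fin N → Fin d) ℂ)
    (P : Fin 2 → Matrix (Fin N → Fin d × Fin d) (Fin N → Fin d × Fin d) ℂ)
    (U₁ U₂ : Matrix.unitaryGroup (Fin d) ℂ) : ℝ :=
  1 / 2 * (P 0 * tensorPowMap N (channelTwo U₂) ρ).trace.re
    + 1 / 2 * (P 1 * tensorPowMap N (channelOne U₁) ρ).trace.re

/-- The worst case of `p_err(U₁, U₂)` over `U₁, U₂ ∈ 𝒰`. -/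
def worstCaseError {d N : ℕ} (𝒰 : Set (Matrix.unitaryGroup (Fin d) ℂ))
    (ρ : Matrix (Fin N → Fin d) (Fin N → Fin d) ℂ)
    (P : Fin 2 → Matrix (Fin N → Fin d × Fin d) (Fin N → Fin d × Fin d) ℂ) : ℝ :=
  ⨆ V : 𝒰 × 𝒰, errorProb ρ P V.1 V.2

/-! ### Sets of unitaries and guessing the unitary -/

/-- `𝒰` is a generalised `N`-design for the unitary representation `π` of the compact group `G`
with normalised invariant measure `μ`. -/
structure IsGeneralisedDesign {d : ℕ} {G : Type*} [Group G] [TopologicalSpace G]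
    [MeasurableSpace G] (N : ℕ) (π : G →* Matrix.unitaryGroup (Fin d) ℂ) (μ : Measure G)
    (𝒰 : Finset (Matrix.unitaryGroup (Fin d) ℂ)) : Prop where
  continuous_rep : Continuous π
  mem_range : ∀ U ∈ 𝒰, U ∈ Set.range π
  average_eq : ∀ (A : Matrix (Fin N → Fin d) (Fin N → Fin d) ℂ) (i j : Fin N → Fin d),
    (𝒰.card : ℂ)⁻¹ * ∑ U ∈ 𝒰,
        (tensorPow N (U : Matrix (Fin d) (Fin d) ℂ) * A *
          (tensorPow N (U : Matrix (Fin d) (Fin d) ℂ)).conjTranspose) i j =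
      ∫ g, (tensorPow N (π g : Matrix (Fin d) (Fin d) ℂ) * A *
          (tensorPow N (π g : Matrix (Fin d) (Fin d) ℂ)).conjTranspose) i j ∂μ

/-- `Ψ_U = U^{⊗N} |Ψ⟩⟨Ψ| U^{⊗N†}`. -/
def rotatedState {d N : ℕ} (ψ : EuclideanSpace ℂ (Fin N → Fin d))
    (U : Matrix.unitaryGroup (Fin d) ℂ) : Matrix (Fin N → Fin d) (Fin N → Fin d) ℂ :=
  tensorPow N (U : Matrix (Fin d) (Fin d) ℂ) * pureState ψ *
    (tensorPow N (U : Matrix (Fin d) (Fin d) ℂ)).conjTranspose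

/-- `⟨Ψ⟩ = |𝒰|⁻¹ ∑_{U ∈ 𝒰} Ψ_U`. -/
def averageState {d N : ℕ} (𝒰 : Finset (Matrix.unitaryGroup (Fin d) ℂ))
    (ψ : EuclideanSpace ℂ (Fin N → Fin d)) : Matrix (Fin N → Fin d) (Fin N → Fin d) ℂ :=
  (𝒰.card : ℂ)⁻¹ • ∑ U ∈ 𝒰, rotatedState ψ U

/-- `Tr √⟨Ψ⟩`. -/
def traceSqrt {d N : ℕ} (𝒰 : Finset (Matrix.unitaryGroup (Fin d) ℂ))
    (ψ : EuclideanSpace ℂ (Fin N → Fin d)) : ℝ :=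
  (cfc Real.sqrt (averageState 𝒰 ψ)).trace.re

/-- The probability of guessing correctly a uniformly random `U ∈ 𝒰` from `U^{⊗N}|Ψ⟩` with the
measurement `P`. -/
def successProb {d N : ℕ} (𝒰 : Finset (Matrix.unitaryGroup (Fin d) ℂ))
    (ψ : EuclideanSpace ℂ (Fin N → Fin d))
    (P : 𝒰 → Matrix (Fin N → Fin d) (Fin N → Fin d) ℂ) : ℝ :=
  (𝒰.card : ℝ)⁻¹ * ∑ U : 𝒰, (P U * rotatedState ψ U.1).trace.re

/-- The optimal guessing probability `p_guess`. -/
def guessProb {d N : ℕ} (𝒰 : Finset (Matrix.unitaryGroup (Fin d) ℂ))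
    (ψ : EuclideanSpace ℂ (Fin N → Fin d)) : ℝ :=
  sSup {p | ∃ P : 𝒰 → Matrix (Fin N → Fin d) (Fin N → Fin d) ℂ,
    IsPOVM P ∧ p = successProb 𝒰 ψ P}

/-- The square-root measurement `P_U = ⟨Ψ⟩^{-1/2} Ψ_U ⟨Ψ⟩^{-1/2} / |𝒰|`. Since `(√0)⁻¹ = 0` in `ℝ`,
`⟨Ψ⟩^{-1/2}` is the inverse square root on the support of `⟨Ψ⟩` and zero on its kernel. -/
def sqrtMeasurement {d N : ℕ} (𝒰 : Finset (Matrix.unitaryGroup (Fin d) ℂ))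
    (ψ : EuclideanSpace ℂ (Fin N → Fin d)) (U : 𝒰) :
    Matrix (Fin N → Fin d) (Fin N → Fin d) ℂ :=
  (𝒰.card : ℂ)⁻¹ • (cfc (fun x : ℝ => (Real.sqrt x)⁻¹) (averageState 𝒰 ψ) *
    rotatedState ψ U.1 * cfc (fun x : ℝ => (Real.sqrt x)⁻¹) (averageState 𝒰 ψ))

/-! ### The singlet strategy -/

/-- The totally antisymmetric tensor `ε_{k₁…k_d}`. -/
def leviCivita {d : ℕ} (k : Fin d → Fin d) : ℂ :=
  ∑ σ : Equiv.Perm (Fin d), if k = σ then ((Equiv.Perm.sign σ : ℤ) : ℂ) else 0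

/-- `|S_d⟩^{⊗t}` on `t * d` particles, where
`|S_d⟩ = (d!)^{-1/2} ∑ ε_{k₁…k_d} |k₁⟩⋯|k_d⟩`; the `s`-th group consists of the particles
`s * d, …, s * d + d - 1`. -/
def singletPow (d t : ℕ) : EuclideanSpace ℂ (Fin (t * d) → Fin d) :=
  WithLp.toLp 2 fun k =>
    ∏ s : Fin t, ((Real.sqrt (d ! : ℝ) : ℂ)⁻¹ * leviCivita fun a => k (finProdFinEquiv (s, a)))

end CausalIntermediary

end

open CausalIntermediary

/-!
Up to a reordering of the outputs, `C_{1,U}^{⊗N}(ρ)` is `ρ_U ⊗ I/d^N` and `C_{2,U}^{⊗N}(ρ)` is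
`I/d^N ⊗ ρ_U`, where `ρ_U = U^{⊗N} ρ U^{⊗N†}` (`tensorPowMap_channelOne`,
`tensorPowMap_channelTwo`). The operators `ω ⊗ 1` and `1 ⊗ ω` commute, with weights `p i` and `p j`
on the product eigenvector `(i, j)`, where `p` is the spectrum of `ω`. Hence every measurement has
error at least `(2 d^N)⁻¹ ∑ i j, min (p i) (p j)` (`sum_min_eigenvalues_le`). The diagonal terms
contribute `∑ i, p i = 1`. This gives the bound `1 / (2 d^N)` for a single gate, and so for every
non-empty set of gates.

For the complementarity relation take `ω = ⟨Ψ⟩`: the worst case over `𝒰` is at least the average of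
the errors for `U₁ = U₂ = U`, which is the error for `⟨Ψ⟩` (`le_worstCaseError_average`). By
Cauchy–Schwarz the terms with `i ≠ j` contribute at least
`((∑ i, √(p i)) ^ 2 - 1) ^ 2 / (2 (d^N - 1))` (`one_add_sq_le_sum_min`), and `∑ i, √(p i)` is
`Tr √⟨Ψ⟩`, which determines `p_guess`.

For the guessing probability, the design property and the invariance of the Haar measure make `⟨Ψ⟩`
commute with `U^{⊗N}` for `U ∈ 𝒰` (`IsGeneralisedDesign.rotate_average`). So `Tr[f(⟨Ψ⟩) Ψ_U]` does
not depend on `U` and equals `Tr[f(⟨Ψ⟩) ⟨Ψ⟩]` (`trace_cfc_mul_rotatedState`). With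
`f(x) = x^{-1/2}` this yields both `Ψ_U ≤ (Tr √⟨Ψ⟩) √⟨Ψ⟩`, which bounds every measurement, and the
success probability of the square-root measurement. If `p_guess = 1/|𝒰|` then `Tr √⟨Ψ⟩ = 1`, and
this operator inequality between operators of trace one is an equality. All the `Ψ_U` coincide then,
and projecting the first outputs on this common state errs with probability exactly `1 / (2 d^N)`.
The singlet is another instance: `U^{⊗d}` acts on it as `det U`.
-/

namespace CausalIntermediary

/-! ### Functions of Hermitian matrices -/

section Matrices

variable {κ : Type*} [Fintype κ] [DecidableEq κ]

/-- No continuity assumption is needed, since the spectrum is finite. -/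
theorem cfc_mul_cfc (f g : ℝ → ℝ) (A : Matrix κ κ ℂ) :
    cfc f A * cfc g A = cfc (fun x => f x * g x) A :=
  (cfc_mul f g A (Matrix.finite_real_spectrum.continuousOn f)
    (Matrix.finite_real_spectrum.continuousOn g)).symm

theorem trace_cfc {A : Matrix κ κ ℂ} (hA : A.IsHermitian) (f : ℝ → ℝ) :
    (cfc f A).trace = ∑ i, (f (hA.eigenvalues i) : ℂ) := by
  rw [hA.cfc_eq, Matrix.IsHermitian.cfc, Unitary.conjStarAlgAut_apply, Matrix.trace_mul_cycle,
    Unitary.coe_star_mul_self, one_mul, Matrix.trace_diagonal]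
  rfl

theorem posSemidef_cfc {A : Matrix κ κ ℂ} (hA : A.IsHermitian) {f : ℝ → ℝ}
    (hf : ∀ i, 0 ≤ f (hA.eigenvalues i)) : (cfc f A).PosSemidef := by
  rw [hA.cfc_eq, Matrix.IsHermitian.cfc, Unitary.conjStarAlgAut_apply]
  refine Matrix.PosSemidef.mul_mul_conjTranspose_same ?_ _
  refine Matrix.PosSemidef.diagonal fun i => ?_
  simpa using hf i

theorem isHermitian_cfc (f : ℝ → ℝ) (A : Matrix κ κ ℂ) : (cfc f A).IsHermitian :=
  (cfc_predicate f A : IsSelfAdjoint _)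

theorem cfc_congr_nonneg {A : Matrix κ κ ℂ} (hA : A.PosSemidef) {f g : ℝ → ℝ}
    (h : ∀ x, 0 ≤ x → f x = g x) : cfc f A = cfc g A := by
  refine cfc_congr fun x hx => h x ?_
  obtain ⟨i, rfl⟩ := hA.1.spectrum_real_eq_range_eigenvalues ▸ hx
  exact hA.eigenvalues_nonneg i

theorem re_trace_mul_nonneg {A B : Matrix κ κ ℂ} (hA : A.PosSemidef) (hB : B.PosSemidef) :
    0 ≤ (A * B).trace.re := by
  have hB' : B = cfc Real.sqrt B * cfc Real.sqrt B := by
    rw [cfc_mul_cfc, cfc_congr_nonneg hB (g := fun x => x) fun x hx => Real.mul_self_sqrt hx,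
      cfc_id' ℝ B hB.1.isSelfAdjoint]
  rw [hB', ← mul_assoc, Matrix.trace_mul_comm, ← mul_assoc]
  have h := hA.mul_mul_conjTranspose_same (cfc Real.sqrt B)
  rw [(isHermitian_cfc _ _).eq] at h
  exact (Complex.le_def.mp h.trace_nonneg).1

theorem cfc_mul_self {A : Matrix κ κ ℂ} (hA : A.IsHermitian) (f : ℝ → ℝ) :
    cfc f A * A = cfc (fun x => f x * x) A := by
  conv_lhs => enter [2]; rw [← cfc_id ℝ A hA.isSelfAdjoint]
  exact cfc_mul_cfc f id A

/-- A positive semidefinite matrix is dominated by its trace, since none of its eigenvalues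
exceeds their sum. -/
theorem posSemidef_trace_smul_one_sub {A : Matrix κ κ ℂ} (hA : A.PosSemidef) :
    (A.trace • (1 : Matrix κ κ ℂ) - A).PosSemidef := by
  have hsum : A.trace = ((∑ i, hA.1.eigenvalues i : ℝ) : ℂ) := by
    simpa using hA.1.trace_eq_sum_eigenvalues
  have h : A.trace • (1 : Matrix κ κ ℂ) - A =
      cfc (fun x : ℝ => (∑ i, hA.1.eigenvalues i) - x) A := by
    rw [cfc_sub (fun _ => ∑ i, hA.1.eigenvalues i) (fun x => x) A
      (Matrix.finite_real_spectrum.continuousOn _) (Matrix.finite_real_spectrum.continuousOn _),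
      cfc_const _ A hA.1.isSelfAdjoint, cfc_id' ℝ A hA.1.isSelfAdjoint, hsum]
    congr 1
    ext i j
    simp [Matrix.algebraMap_matrix_apply, Matrix.one_apply]
  rw [h]
  refine posSemidef_cfc hA.1 fun i => ?_
  have := Finset.single_le_sum (f := hA.1.eigenvalues) (fun j _ => hA.eigenvalues_nonneg j)
    (Finset.mem_univ i)
  linarith

omit [DecidableEq κ] in
theorem trace_mul_vecMulVec (A : Matrix κ κ ℂ) (v w : κ → ℂ) :
    (A * Matrix.vecMulVec v w).trace = w ⬝ᵥ A.mulVec v := by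
  rw [Matrix.mul_vecMulVec, Matrix.trace_vecMulVec, dotProduct_comm]

omit [DecidableEq κ] in
theorem vecMulVec_mul_mul_vecMulVec (A : Matrix κ κ ℂ) (v w : κ → ℂ) :
    Matrix.vecMulVec v w * A * Matrix.vecMulVec v w =
      (A * Matrix.vecMulVec v w).trace • Matrix.vecMulVec v w := by
  rw [trace_mul_vecMulVec, mul_assoc, Matrix.mul_vecMulVec, Matrix.vecMulVec_mul_vecMulVec]
  ext i j
  simp [Matrix.vecMulVec_apply, mul_left_comm]

/-- If every function of `ω` has the same expectation in `v v†` as in `ω`, then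
`v v† ≤ (Tr √ω) √ω`. The vector `v` lies in the support of `ω`, so that `v = ω^{1/4} w` with
`w = ω^{-1/4} v`, where `w w† ≤ ‖w‖² 1` and `‖w‖² = ⟨v, ω^{-1/2} v⟩ = Tr √ω`. -/
theorem posSemidef_trace_sqrt_smul_sqrt_sub {ω : Matrix κ κ ℂ} (hω : ω.PosSemidef) (v : κ → ℂ)
    (h : ∀ f : ℝ → ℝ, (cfc f ω * Matrix.vecMulVec v (star v)).trace = (cfc f ω * ω).trace) :
    ((cfc Real.sqrt ω).trace • cfc Real.sqrt ω - Matrix.vecMulVec v (star v)).PosSemidef := by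
  set Ψ := Matrix.vecMulVec v (star v) with hΨ
  set S := cfc (fun x : ℝ => √√x) ω
  set R := cfc (fun x : ℝ => (√√x)⁻¹) ω
  set Q := cfc (fun x : ℝ => if x = 0 then (1 : ℝ) else 0) ω
  have hS : S.IsHermitian := isHermitian_cfc _ _
  have hR : R.IsHermitian := isHermitian_cfc _ _
  have hQ : Q.IsHermitian := isHermitian_cfc _ _
  have hΨp : Ψ.PosSemidef := Matrix.posSemidef_vecMulVec_self_star v
  -- the kernel projection of `ω` annihilates `v`
  have hQQ : Q * Q = Q := by
    rw [cfc_mul_cfc]; congr 1; ext x; split_ifs <;> simp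
  have hQω : (Q * Ψ).trace = 0 := by
    have h0 : (fun x : ℝ => (if x = 0 then (1 : ℝ) else 0) * x) = fun _ => 0 := by
      ext x; split_ifs with hx <;> simp [hx]
    rw [h, cfc_mul_self hω.1, h0, cfc_const_zero, Matrix.trace_zero]
  have hQv : Q * Ψ = 0 := by
    have h1 : Matrix.vecMulVec (Q.mulVec v) (star (Q.mulVec v)) = Q * Ψ * Q := by
      rw [hΨ, Matrix.mul_vecMulVec, Matrix.vecMulVec_mul, Matrix.star_mulVec, hQ.eq]
    have h2 : (Matrix.vecMulVec (Q.mulVec v) (star (Q.mulVec v))).trace = 0 := by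
      rw [h1, Matrix.trace_mul_comm, ← mul_assoc, hQQ, hQω]
    rw [Matrix.trace_vecMulVec, dotProduct_self_star_eq_zero] at h2
    rw [hΨ, Matrix.mul_vecMulVec, h2, Matrix.zero_vecMulVec]
  have hΨQ : Ψ * Q = 0 := by
    simpa [hQ.eq, hΨp.1.eq] using congrArg Matrix.conjTranspose hQv
  have hSR : S * R = 1 - Q := by
    rw [cfc_mul_cfc, ← cfc_one ℝ ω hω.1.isSelfAdjoint, ← cfc_sub _ _ ω
      (Matrix.finite_real_spectrum.continuousOn _) (Matrix.finite_real_spectrum.continuousOn _)]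
    refine cfc_congr_nonneg hω fun x hx => ?_
    rcases hx.eq_or_lt with rfl | hx
    · simp
    · have : √√x ≠ 0 := by positivity
      simp [this, hx.ne']
  have hRS : R * S = 1 - Q := by
    rw [← hSR, cfc_mul_cfc, cfc_mul_cfc]; congr 1; ext x; ring
  have hΨe : Ψ = S * (R * Ψ * R) * S := by
    calc Ψ = (1 - Q) * Ψ * (1 - Q) := by simp [sub_mul, mul_sub, hQv, hΨQ]
      _ = (S * R) * Ψ * (R * S) := by rw [hSR, hRS]
      _ = S * (R * Ψ * R) * S := by simp only [mul_assoc]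
  have hSS : S * S = cfc Real.sqrt ω := by
    rw [cfc_mul_cfc]; congr 1; ext x; exact Real.mul_self_sqrt (Real.sqrt_nonneg x)
  have ht : (R * Ψ * R).trace = (cfc Real.sqrt ω).trace := by
    rw [Matrix.trace_mul_comm, ← mul_assoc, cfc_mul_cfc, h, cfc_mul_self hω.1]
    congr 1
    refine cfc_congr_nonneg hω fun x _ => ?_
    rw [← mul_inv, Real.mul_self_sqrt (Real.sqrt_nonneg x), inv_mul_eq_div, Real.div_sqrt]
  have hX : (R * Ψ * R).PosSemidef := by
    have := hΨp.mul_mul_conjTranspose_same R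
    rwa [hR.eq] at this
  have := (posSemidef_trace_smul_one_sub hX).mul_mul_conjTranspose_same S
  rw [hS.eq, mul_sub, sub_mul, ← hΨe, ht] at this
  simpa [hSS] using this

end Matrices

/-! ### Tensor powers of the gates and of the two channels -/

section TensorPowers

variable {d N : ℕ}

theorem tensorPow_mul (A B : Matrix (Fin d) (Fin d) ℂ) :
    tensorPow N (A * B) = tensorPow N A * tensorPow N B := by
  ext i j
  simp only [tensorPow, Matrix.of_apply, Matrix.mul_apply, ← Finset.prod_mul_distrib]
  rw [Finset.prod_univ_sum, Fintype.piFinset_univ]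

theorem tensorPow_one : tensorPow N (1 : Matrix (Fin d) (Fin d) ℂ) = 1 := by
  ext i j
  simp [tensorPow, Matrix.one_apply, Finset.prod_ite_zero, funext_iff]

theorem conjTranspose_tensorPow (A : Matrix (Fin d) (Fin d) ℂ) :
    (tensorPow N A).conjTranspose = tensorPow N A.conjTranspose := by
  ext i j
  simp [tensorPow, Matrix.conjTranspose_apply]

theorem conjTranspose_tensorPow_mul_self (U : Matrix.unitaryGroup (Fin d) ℂ) :
    (tensorPow N (U : Matrix (Fin d) (Fin d) ℂ)).conjTranspose * tensorPow N U = 1 := by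
  rw [conjTranspose_tensorPow, ← tensorPow_mul]
  have := Unitary.coe_star_mul_self U
  rw [Matrix.star_eq_conjTranspose] at this
  rw [this, tensorPow_one]

/-- The state `U^{⊗N} ρ U^{⊗N†}`; for a pure `ρ` it is a `rotatedState`. -/
def rotate (U : Matrix.unitaryGroup (Fin d) ℂ) (ρ : Matrix (Fin N → Fin d) (Fin N → Fin d) ℂ) :
    Matrix (Fin N → Fin d) (Fin N → Fin d) ℂ :=
  tensorPow N (U : Matrix (Fin d) (Fin d) ℂ) * ρ *
    (tensorPow N (U : Matrix (Fin d) (Fin d) ℂ)).conjTranspose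

theorem IsDensity.rotate {ρ : Matrix (Fin N → Fin d) (Fin N → Fin d) ℂ} (hρ : IsDensity ρ)
    (U : Matrix.unitaryGroup (Fin d) ℂ) : IsDensity (rotate U ρ) where
  posSemidef := hρ.posSemidef.mul_mul_conjTranspose_same _
  trace_eq_one := by
    rw [CausalIntermediary.rotate, Matrix.trace_mul_comm, ← mul_assoc,
      conjTranspose_tensorPow_mul_self, one_mul, hρ.trace_eq_one]

theorem conj_single_apply (U : Matrix (Fin d) (Fin d) ℂ) (i j a b : Fin d) :
    (U * Matrix.single i j (1 : ℂ) * U.conjTranspose) a b = U a i * star (U b j) := by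
  simp [Matrix.mul_apply, Matrix.single_apply, ite_and, Finset.sum_ite_eq]

theorem rotate_apply (U : Matrix.unitaryGroup (Fin d) ℂ)
    (ρ : Matrix (Fin N → Fin d) (Fin N → Fin d) ℂ) (a b : Fin N → Fin d) :
    rotate U ρ a b = ∑ i, ∑ j, ρ i j * ∏ k,
      ((U : Matrix (Fin d) (Fin d) ℂ) (a k) (i k) *
        star ((U : Matrix (Fin d) (Fin d) ℂ) (b k) (j k))) := by
  simp only [rotate, Matrix.mul_apply, Finset.sum_mul]
  rw [Finset.sum_comm]
  refine Finset.sum_congr rfl fun i _ => Finset.sum_congr rfl fun j _ => ?_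
  simp only [tensorPow, Matrix.of_apply, Matrix.conjTranspose_apply, star_prod,
    Finset.prod_mul_distrib]
  ring

/-- The reordering of `N` output pairs `(B₁C₁)⋯(B_NC_N)` as `(B₁⋯B_N)(C₁⋯C_N)`. -/
abbrev splitOutputs (d N : ℕ) :
    (Fin N → Fin d × Fin d) ≃ (Fin N → Fin d) × (Fin N → Fin d) :=
  Equiv.arrowProdEquivProdArrow (Fin N) (fun _ => Fin d) (fun _ => Fin d)

theorem tensorPowMap_channelOne (U : Matrix.unitaryGroup (Fin d) ℂ)
    (ρ : Matrix (Fin N → Fin d) (Fin N → Fin d) ℂ) :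
    tensorPowMap N (channelOne U) ρ =
      ((d : ℂ) ^ N)⁻¹ • (rotate U ρ ⊗ₖ (1 : Matrix (Fin N → Fin d) (Fin N → Fin d) ℂ)).submatrix
        (splitOutputs d N) (splitOutputs d N) := by
  ext p q
  simp only [tensorPowMap, channelOne, LinearMap.coe_mk, AddHom.coe_mk, Matrix.of_apply,
    Matrix.kroneckerMap_apply, conj_single_apply, Matrix.smul_apply, Matrix.submatrix_apply,
    rotate_apply, Finset.prod_mul_distrib, smul_eq_mul, ← tensorPow_one]
  simp only [tensorPow, Matrix.of_apply, Finset.prod_const, Finset.card_univ, Fintype.card_fin,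
    Finset.mul_sum, Finset.sum_mul, Equiv.arrowProdEquivProdArrow_apply, inv_pow]
  refine Finset.sum_congr rfl fun i _ => Finset.sum_congr rfl fun j _ => ?_
  ring

theorem tensorPowMap_channelTwo (U : Matrix.unitaryGroup (Fin d) ℂ)
    (ρ : Matrix (Fin N → Fin d) (Fin N → Fin d) ℂ) :
    tensorPowMap N (channelTwo U) ρ =
      ((d : ℂ) ^ N)⁻¹ • ((1 : Matrix (Fin N → Fin d) (Fin N → Fin d) ℂ) ⊗ₖ rotate U ρ).submatrix
        (splitOutputs d N) (splitOutputs d N) := by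
  ext p q
  simp only [tensorPowMap, channelTwo, LinearMap.coe_mk, AddHom.coe_mk, Matrix.of_apply,
    Matrix.kroneckerMap_apply, conj_single_apply, Matrix.smul_apply, Matrix.submatrix_apply,
    rotate_apply, Finset.prod_mul_distrib, smul_eq_mul, ← tensorPow_one]
  simp only [tensorPow, Matrix.of_apply, Finset.prod_const, Finset.card_univ, Fintype.card_fin,
    Finset.mul_sum, Equiv.arrowProdEquivProdArrow_apply, inv_pow]
  refine Finset.sum_congr rfl fun i _ => Finset.sum_congr rfl fun j _ => ?_
  ring

theorem trace_submatrix_equiv {m n : Type*} [Fintype m] [Fintype n] (e : m ≃ n)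
    (A : Matrix n n ℂ) : (A.submatrix e e).trace = A.trace :=
  Equiv.sum_comp e fun i => A i i

theorem trace_mul_submatrix {m n : Type*} [Fintype m] [Fintype n] (e : m ≃ n)
    (A : Matrix m m ℂ) (B : Matrix n n ℂ) :
    (A * B.submatrix e e).trace = (A.submatrix e.symm e.symm * B).trace := by
  rw [← trace_submatrix_equiv e, ← Matrix.submatrix_mul_equiv _ _ _ e]
  simp

theorem errorProb_eq (ρ : Matrix (Fin N → Fin d) (Fin N → Fin d) ℂ)
    (P : Fin 2 → Matrix (Fin N → Fin d × Fin d) (Fin N → Fin d × Fin d) ℂ)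
    (U₁ U₂ : Matrix.unitaryGroup (Fin d) ℂ) :
    errorProb ρ P U₁ U₂ = 1 / (2 * (d : ℝ) ^ N) *
      (((P 0).submatrix (splitOutputs d N).symm (splitOutputs d N).symm *
          (1 : Matrix (Fin N → Fin d) (Fin N → Fin d) ℂ) ⊗ₖ rotate U₂ ρ).trace.re +
        ((P 1).submatrix (splitOutputs d N).symm (splitOutputs d N).symm *
          rotate U₁ ρ ⊗ₖ (1 : Matrix (Fin N → Fin d) (Fin N → Fin d) ℂ)).trace.re) := by
  have h (z : ℂ) : (((d : ℂ) ^ N)⁻¹ * z).re = ((d : ℝ) ^ N)⁻¹ * z.re := by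
    rw [← Complex.re_ofReal_mul]; push_cast; rfl
  rw [errorProb, tensorPowMap_channelOne, tensorPowMap_channelTwo, Matrix.mul_smul,
    Matrix.mul_smul, Matrix.trace_smul, Matrix.trace_smul, trace_mul_submatrix,
    trace_mul_submatrix, smul_eq_mul, smul_eq_mul, h, h]
  ring

theorem IsPOVM.submatrix_equiv {ι m n : Type*} [Fintype ι] [Fintype m] [Fintype n] [DecidableEq m]
    [DecidableEq n] {P : ι → Matrix m m ℂ} (hP : IsPOVM P) (e : n ≃ m) :
    IsPOVM fun x => (P x).submatrix e e where
  posSemidef x := (hP.posSemidef x).submatrix e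
  sum_eq_one := by
    have := congrArg (fun A : Matrix m m ℂ => A.submatrix e e) hP.sum_eq_one
    simp only [Matrix.submatrix_one_equiv] at this
    rw [← this]
    ext i j
    simp [Matrix.sum_apply]

end TensorPowers

/-! ### Discriminating `ω ⊗ 1` from `1 ⊗ ω` -/

section Discrimination

variable {κ : Type*} [Fintype κ] [DecidableEq κ]

open Matrix in
/-- Discriminating `ω ⊗ 1` from `1 ⊗ ω`: the two operators are diagonal in the product eigenbasis,
where the smaller of the two weights `p i`, `p j` is an unavoidable error on `(i, j)`. -/
theorem sum_min_eigenvalues_le {ω : Matrix κ κ ℂ} (hω : ω.IsHermitian)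
    {Q : Fin 2 → Matrix (κ × κ) (κ × κ) ℂ} (hQ : IsPOVM Q) :
    ∑ i, ∑ j, min (hω.eigenvalues i) (hω.eigenvalues j) ≤
      (Q 0 * (1 : Matrix κ κ ℂ) ⊗ₖ ω).trace.re + (Q 1 * ω ⊗ₖ (1 : Matrix κ κ ℂ)).trace.re := by
  set V : Matrix κ κ ℂ := hω.eigenvectorUnitary.1
  set D : Matrix κ κ ℂ := diagonal fun i => (hω.eigenvalues i : ℂ) with hD
  have hVV : V * Vᴴ = 1 := Unitary.coe_mul_star_self hω.eigenvectorUnitary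
  have hVV' : Vᴴ * V = 1 := Unitary.coe_star_mul_self hω.eigenvectorUnitary
  have hωD : ω = V * D * Vᴴ := by
    conv_lhs => rw [hω.spectral_theorem, Unitary.conjStarAlgAut_apply]
    rfl
  set W : Matrix (κ × κ) (κ × κ) ℂ := V ⊗ₖ V with hW
  have hWW : Wᴴ * W = 1 := by
    rw [hW, conjTranspose_kronecker, ← mul_kronecker_mul, hVV', one_kronecker_one]
  have h0 : (1 : Matrix κ κ ℂ) ⊗ₖ ω = W * ((1 : Matrix κ κ ℂ) ⊗ₖ D) * Wᴴ := by
    rw [hW, conjTranspose_kronecker, ← mul_kronecker_mul, ← mul_kronecker_mul, mul_one,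
      hVV, ← hωD]
  have h1 : ω ⊗ₖ (1 : Matrix κ κ ℂ) = W * (D ⊗ₖ (1 : Matrix κ κ ℂ)) * Wᴴ := by
    rw [hW, conjTranspose_kronecker, ← mul_kronecker_mul, ← mul_kronecker_mul, mul_one,
      hVV, ← hωD]
  have hR (x) : (Wᴴ * Q x * W).PosSemidef := (hQ.posSemidef x).conjTranspose_mul_mul_same W
  have hR1 : Wᴴ * Q 0 * W + Wᴴ * Q 1 * W = 1 := by
    have := hQ.sum_eq_one
    rw [Fin.sum_univ_two] at this
    rw [← add_mul, ← mul_add, this, mul_one, hWW]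
  have hcyc (A B : Matrix (κ × κ) (κ × κ) ℂ) :
      (A * (W * B * Wᴴ)).trace = (Wᴴ * A * W * B).trace := by
    rw [← mul_assoc, trace_mul_comm]
    simp only [mul_assoc]
  rw [h0, h1, hcyc, hcyc, hD, ← diagonal_one, diagonal_kronecker_diagonal,
    diagonal_kronecker_diagonal, ← Fintype.sum_prod_type', trace, trace, Complex.re_sum,
    Complex.re_sum, ← Finset.sum_add_distrib]
  refine Finset.sum_le_sum fun x _ => ?_
  have e0 := (Complex.le_def.mp ((hR 0).diag_nonneg (i := x))).1
  have e1 := (Complex.le_def.mp ((hR 1).diag_nonneg (i := x))).1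
  have e2 := congrArg Complex.re (congrFun (congrFun hR1 x) x)
  simp only [diag_apply, mul_diagonal, one_mul, mul_one, Complex.re_mul_ofReal]
  simp only [Matrix.add_apply, one_apply_eq, Complex.add_re, Complex.one_re,
    Complex.zero_re] at e0 e1 e2
  set a := ((Wᴴ * Q 0 * W) x x).re
  set b := ((Wᴴ * Q 1 * W) x x).re
  have m0 := mul_le_mul_of_nonneg_left (min_le_right (hω.eigenvalues x.1) (hω.eigenvalues x.2)) e0
  have m1 := mul_le_mul_of_nonneg_left (min_le_left (hω.eigenvalues x.1) (hω.eigenvalues x.2)) e1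
  calc _ = (a + b) * min (hω.eigenvalues x.1) (hω.eigenvalues x.2) := by rw [e2, one_mul]
    _ ≤ _ := by rw [add_mul]; exact add_le_add m0 m1

end Discrimination

/-! ### Inequalities for probability vectors -/

section Inequalities

variable {κ : Type*} [Fintype κ] [DecidableEq κ]

theorem sum_sum_eq_diag_add_offDiag (F : κ → κ → ℝ) :
    ∑ i, ∑ j, F i j = ∑ i, F i i + ∑ x ∈ (Finset.univ : Finset κ).offDiag, F x.1 x.2 := by
  rw [← Fintype.sum_prod_type', ← Finset.univ_product_univ, ← Finset.diag_union_offDiag,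
    Finset.sum_union (Finset.disjoint_diag_offDiag _), Finset.sum_diag]

/-- Cauchy–Schwarz for `√(p i p j) = √min(p i, p j) √max(p i, p j)` over the pairs `i ≠ j`, where
`max(p i, p j) ≤ p i + p j`. -/
theorem one_add_sq_le_sum_min {p : κ → ℝ} (hp : ∀ i, 0 ≤ p i) (hsum : ∑ i, p i = 1)
    (hcard : 1 < Fintype.card κ) :
    1 + 1 / (2 * ((Fintype.card κ : ℝ) - 1)) * ((∑ i, √(p i)) ^ 2 - 1) ^ 2 ≤
      ∑ i, ∑ j, min (p i) (p j) := by
  set O := (Finset.univ : Finset κ).offDiag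
  have hmin : ∑ i, ∑ j, min (p i) (p j) = 1 + ∑ x ∈ O, min (p x.1) (p x.2) := by
    rw [sum_sum_eq_diag_add_offDiag]; simp [hsum, O]
  have hsqrt : (∑ i, √(p i)) ^ 2 - 1 = ∑ x ∈ O, √(p x.1) * √(p x.2) := by
    rw [sq, Finset.sum_mul_sum, sum_sum_eq_diag_add_offDiag]
    simp [Real.mul_self_sqrt (hp _), hsum, O]
  have hmax : ∑ x ∈ O, max (p x.1) (p x.2) ≤ 2 * ((Fintype.card κ : ℝ) - 1) := by
    have h1 : ∑ x ∈ O, max (p x.1) (p x.2) ≤ ∑ x ∈ O, (p x.1 + p x.2) :=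
      Finset.sum_le_sum fun x _ => max_le_add_of_nonneg (hp _) (hp _)
    have h2 := sum_sum_eq_diag_add_offDiag fun i j => p i + p j
    simp only [Finset.sum_add_distrib, Finset.sum_const, hsum, Finset.card_univ, nsmul_eq_mul,
      mul_one, ← Finset.mul_sum] at h2 h1
    linarith
  have hcs : (∑ x ∈ O, √(p x.1) * √(p x.2)) ^ 2 ≤
      (∑ x ∈ O, min (p x.1) (p x.2)) * ∑ x ∈ O, max (p x.1) (p x.2) := by
    have := Finset.sum_mul_sq_le_sq_mul_sq O (fun x => √(min (p x.1) (p x.2)))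
      (fun x => √(max (p x.1) (p x.2)))
    have e0 (x : κ × κ) : √(min (p x.1) (p x.2)) * √(max (p x.1) (p x.2)) =
        √(p x.1) * √(p x.2) := by
      rw [← Real.sqrt_mul (le_min (hp _) (hp _)), min_mul_max, Real.sqrt_mul (hp _)]
    have e1 (x : κ × κ) : √(min (p x.1) (p x.2)) ^ 2 = min (p x.1) (p x.2) :=
      Real.sq_sqrt (le_min (hp _) (hp _))
    have e2 (x : κ × κ) : √(max (p x.1) (p x.2)) ^ 2 = max (p x.1) (p x.2) :=
      Real.sq_sqrt (le_max_of_le_left (hp _))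
    simpa only [e0, e1, e2] using this
  have hn : (0 : ℝ) < 2 * ((Fintype.card κ : ℝ) - 1) := by
    have : (1 : ℝ) < Fintype.card κ := by exact_mod_cast hcard
    linarith
  have hm0 : 0 ≤ ∑ x ∈ O, min (p x.1) (p x.2) :=
    Finset.sum_nonneg fun x _ => le_min (hp _) (hp _)
  rw [hmin, hsqrt, one_div, inv_mul_eq_div]
  gcongr
  rw [div_le_iff₀ hn]
  exact hcs.trans (mul_le_mul_of_nonneg_left hmax hm0)

theorem one_le_sum_min {p : κ → ℝ} (hp : ∀ i, 0 ≤ p i) (hsum : ∑ i, p i = 1) :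
    1 ≤ ∑ i, ∑ j, min (p i) (p j) := by
  rw [sum_sum_eq_diag_add_offDiag]
  have : 0 ≤ ∑ x ∈ (Finset.univ : Finset κ).offDiag, min (p x.1) (p x.2) :=
    Finset.sum_nonneg fun x _ => le_min (hp _) (hp _)
  simp only [min_self, hsum]
  linarith

theorem IsDensity.sum_eigenvalues {ω : Matrix κ κ ℂ} (hω : IsDensity ω) :
    ∑ i, hω.posSemidef.1.eigenvalues i = 1 := by
  have := hω.posSemidef.1.trace_eq_sum_eigenvalues
  rw [hω.trace_eq_one, ← RCLike.ofReal_sum] at this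
  exact Complex.ofReal_eq_one.mp this.symm

end Inequalities

/-! ### The worst-case error -/

section WorstCase

variable {d N : ℕ}

theorem errorProb_le_one (hd : d ≠ 0) {ρ : Matrix (Fin N → Fin d) (Fin N → Fin d) ℂ}
    (hρ : IsDensity ρ)
    {P : Fin 2 → Matrix (Fin N → Fin d × Fin d) (Fin N → Fin d × Fin d) ℂ} (hP : IsPOVM P)
    (U₁ U₂ : Matrix.unitaryGroup (Fin d) ℂ) : errorProb ρ P U₁ U₂ ≤ 1 := by
  have hQ := hP.submatrix_equiv (splitOutputs d N).symm
  have hD : (0 : ℝ) < (d : ℝ) ^ N := by positivity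
  rw [errorProb_eq]
  set Q := fun x => (P x).submatrix (splitOutputs d N).symm (splitOutputs d N).symm
  have hsum : Q 0 + Q 1 = 1 := by rw [← hQ.sum_eq_one, Fin.sum_univ_two]
  have key (X) (hX : X.PosSemidef) (x : Fin 2) : (Q x * X).trace.re ≤ X.trace.re := by
    have h : X.trace.re = (Q 0 * X).trace.re + (Q 1 * X).trace.re := by
      rw [← Complex.add_re, ← Matrix.trace_add, ← add_mul, hsum, one_mul]
    have h0 := re_trace_mul_nonneg (hQ.posSemidef 0) hX
    have h1 := re_trace_mul_nonneg (hQ.posSemidef 1) hX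
    fin_cases x <;> simp only [Fin.zero_eta, Fin.mk_one] <;> linarith
  have hone : (1 : Matrix (Fin N → Fin d) (Fin N → Fin d) ℂ).trace = ((d ^ N : ℝ) : ℂ) := by
    simp [Matrix.trace_one]
  have h0 := key _ (Matrix.PosSemidef.one.kronecker (hρ.rotate U₂).posSemidef) 0
  have h1 := key _ ((hρ.rotate U₁).posSemidef.kronecker Matrix.PosSemidef.one) 1
  rw [Matrix.trace_kronecker, (hρ.rotate _).trace_eq_one, hone] at h0 h1
  rw [mul_one, Complex.ofReal_re] at h0
  rw [one_mul, Complex.ofReal_re] at h1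
  rw [one_div, inv_mul_eq_div, div_le_one (by positivity)]
  linarith

theorem errorProb_le_worstCaseError (hd : d ≠ 0)
    {ρ : Matrix (Fin N → Fin d) (Fin N → Fin d) ℂ} (hρ : IsDensity ρ)
    {P : Fin 2 → Matrix (Fin N → Fin d × Fin d) (Fin N → Fin d × Fin d) ℂ} (hP : IsPOVM P)
    {𝒱 : Set (Matrix.unitaryGroup (Fin d) ℂ)} {U₁ U₂ : Matrix.unitaryGroup (Fin d) ℂ}
    (h₁ : U₁ ∈ 𝒱) (h₂ : U₂ ∈ 𝒱) : errorProb ρ P U₁ U₂ ≤ worstCaseError 𝒱 ρ P :=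
  le_ciSup (f := fun V : 𝒱 × 𝒱 => errorProb ρ P V.1 V.2)
    ⟨1, by rintro _ ⟨V, rfl⟩; exact errorProb_le_one hd hρ hP _ _⟩ (⟨U₁, h₁⟩, ⟨U₂, h₂⟩)

theorem worstCaseError_eq_of_forall {ρ : Matrix (Fin N → Fin d) (Fin N → Fin d) ℂ}
    {P : Fin 2 → Matrix (Fin N → Fin d × Fin d) (Fin N → Fin d × Fin d) ℂ}
    {𝒱 : Set (Matrix.unitaryGroup (Fin d) ℂ)} (hne : 𝒱.Nonempty) {c : ℝ}
    (h : ∀ U₁ ∈ 𝒱, ∀ U₂ ∈ 𝒱, errorProb ρ P U₁ U₂ = c) : worstCaseError 𝒱 ρ P = c := by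
  have := hne.to_subtype
  have hc : (fun V : 𝒱 × 𝒱 => errorProb ρ P V.1 V.2) = fun _ => c :=
    funext fun V => h _ V.1.2 _ V.2.2
  rw [worstCaseError, hc, ciSup_const]

/-- For `U₁ = U₂ = U` the task is to discriminate `ρ_U ⊗ I/d^N` from `I/d^N ⊗ ρ_U`. -/
theorem le_worstCaseError (hd : d ≠ 0) {𝒱 : Set (Matrix.unitaryGroup (Fin d) ℂ)}
    (hne : 𝒱.Nonempty) {ρ : Matrix (Fin N → Fin d) (Fin N → Fin d) ℂ} (hρ : IsDensity ρ)
    {P : Fin 2 → Matrix (Fin N → Fin d × Fin d) (Fin N → Fin d × Fin d) ℂ} (hP : IsPOVM P) :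
    1 / (2 * (d : ℝ) ^ N) ≤ worstCaseError 𝒱 ρ P := by
  obtain ⟨U, hU⟩ := hne
  refine le_trans ?_ (errorProb_le_worstCaseError hd hρ hP hU hU)
  have hω := hρ.rotate U
  have h1 := one_le_sum_min hω.posSemidef.eigenvalues_nonneg hω.sum_eigenvalues
  have h2 := sum_min_eigenvalues_le hω.posSemidef.1
    (hP.submatrix_equiv (splitOutputs d N).symm)
  rw [errorProb_eq]
  exact le_mul_of_one_le_right (by positivity) (h1.trans h2)

/-- The average of the error probabilities for `U₁ = U₂ ∈ 𝒰` is the error probability of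
discriminating `ω ⊗ I/d^N` from `I/d^N ⊗ ω`, with `ω` the average of the states
`U^{⊗N} ρ U^{⊗N†}`. -/
theorem le_worstCaseError_average (hd : d ≠ 0)
    {𝒰 : Finset (Matrix.unitaryGroup (Fin d) ℂ)} (hne : 𝒰.Nonempty)
    {ρ : Matrix (Fin N → Fin d) (Fin N → Fin d) ℂ} (hρ : IsDensity ρ)
    {P : Fin 2 → Matrix (Fin N → Fin d × Fin d) (Fin N → Fin d × Fin d) ℂ} (hP : IsPOVM P)
    {ω : Matrix (Fin N → Fin d) (Fin N → Fin d) ℂ}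
    (hω : ω = (𝒰.card : ℂ)⁻¹ • ∑ U ∈ 𝒰, rotate U ρ) (hωh : ω.IsHermitian) :
    1 / (2 * (d : ℝ) ^ N) * ∑ i, ∑ j, min (hωh.eigenvalues i) (hωh.eigenvalues j) ≤
      worstCaseError 𝒰 ρ P := by
  have hcard : (0 : ℝ) < 𝒰.card := by exact_mod_cast hne.card_pos
  have h1 : ∑ U ∈ 𝒰, errorProb ρ P U U ≤ 𝒰.card * worstCaseError 𝒰 ρ P := by
    rw [← nsmul_eq_mul]
    exact Finset.sum_le_card_nsmul _ _ _ fun U hU =>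
      errorProb_le_worstCaseError hd hρ hP (by exact_mod_cast hU) (by exact_mod_cast hU)
  have h2 := sum_min_eigenvalues_le hωh (hP.submatrix_equiv (splitOutputs d N).symm)
  have hre (z : ℂ) : ((𝒰.card : ℂ)⁻¹ * z).re = (𝒰.card : ℝ)⁻¹ * z.re := by
    rw [← Complex.re_ofReal_mul]; push_cast; rfl
  have hsl : ω ⊗ₖ (1 : Matrix (Fin N → Fin d) (Fin N → Fin d) ℂ) =
      (𝒰.card : ℂ)⁻¹ • ∑ U ∈ 𝒰, rotate U ρ ⊗ₖ (1 : Matrix (Fin N → Fin d) (Fin N → Fin d) ℂ) := by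
    rw [hω, Matrix.smul_kronecker]
    congr 1
    ext x y
    simp [Matrix.sum_apply, Finset.sum_mul]
  have hsr : (1 : Matrix (Fin N → Fin d) (Fin N → Fin d) ℂ) ⊗ₖ ω =
      (𝒰.card : ℂ)⁻¹ • ∑ U ∈ 𝒰, (1 : Matrix (Fin N → Fin d) (Fin N → Fin d) ℂ) ⊗ₖ rotate U ρ := by
    rw [hω, Matrix.kronecker_smul]
    congr 1
    ext x y
    simp [Matrix.sum_apply, Finset.mul_sum]
  rw [hsl, hsr, Matrix.mul_smul, Matrix.mul_smul, Matrix.trace_smul, Matrix.trace_smul,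
    smul_eq_mul, smul_eq_mul, hre, hre, Matrix.mul_sum, Matrix.mul_sum, Matrix.trace_sum,
    Matrix.trace_sum, Complex.re_sum, Complex.re_sum, ← mul_add, ← Finset.sum_add_distrib] at h2
  calc _ ≤ 1 / (2 * (d : ℝ) ^ N) * _ := mul_le_mul_of_nonneg_left h2 (by positivity)
    _ = (𝒰.card : ℝ)⁻¹ * ∑ U ∈ 𝒰, errorProb ρ P U U := by
      simp only [errorProb_eq, ← Finset.mul_sum]
      ring
    _ ≤ (𝒰.card : ℝ)⁻¹ * (𝒰.card * worstCaseError 𝒰 ρ P) := by gcongr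
    _ = _ := by field_simp

/-- If all the gates take the input to the same pure state `Φ`, projecting the first outputs on `Φ`
never errs under the first hypothesis, and errs with probability `1 / d^N` under the second, where
these outputs are maximally mixed. -/
theorem exists_isPOVM_errorProb_eq
    {ρ Φ : Matrix (Fin N → Fin d) (Fin N → Fin d) ℂ} (hΦ : IsDensity Φ) (hΦΦ : Φ * Φ = Φ)
    {𝒱 : Set (Matrix.unitaryGroup (Fin d) ℂ)} (h : ∀ U ∈ 𝒱, rotate U ρ = Φ) :
    ∃ P : Fin 2 → Matrix (Fin N → Fin d × Fin d) (Fin N → Fin d × Fin d) ℂ, IsPOVM P ∧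
      ∀ U₁ ∈ 𝒱, ∀ U₂ ∈ 𝒱, errorProb ρ P U₁ U₂ = 1 / (2 * (d : ℝ) ^ N) := by
  set Q : Fin 2 → Matrix ((Fin N → Fin d) × (Fin N → Fin d))
      ((Fin N → Fin d) × (Fin N → Fin d)) ℂ :=
    ![Φ ⊗ₖ (1 : Matrix (Fin N → Fin d) (Fin N → Fin d) ℂ), (1 - Φ) ⊗ₖ 1] with hQdef
  have hcomp : (1 - Φ).PosSemidef := by
    have h1 : (1 - Φ).conjTranspose * (1 - Φ) = 1 - Φ := by
      simp [hΦ.posSemidef.1.eq, mul_sub, sub_mul, hΦΦ]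
    rw [← h1]
    exact Matrix.posSemidef_conjTranspose_mul_self _
  have hQ : IsPOVM Q := by
    refine ⟨Fin.forall_fin_two.mpr ⟨?_, ?_⟩, ?_⟩
    · exact hΦ.posSemidef.kronecker Matrix.PosSemidef.one
    · exact hcomp.kronecker Matrix.PosSemidef.one
    · simp [Fin.sum_univ_two, hQdef, ← Matrix.add_kronecker]
  refine ⟨_, hQ.submatrix_equiv (splitOutputs d N), fun U₁ h₁ U₂ h₂ => ?_⟩
  have hone : (1 : Matrix (Fin N → Fin d) (Fin N → Fin d) ℂ).trace = (d : ℂ) ^ N := by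
    simp [Matrix.trace_one]
  rw [errorProb_eq, h _ h₁, h _ h₂]
  simp [hQdef, ← Matrix.mul_kronecker_mul, sub_mul, hΦΦ, Matrix.trace_kronecker, hΦ.trace_eq_one]

end WorstCase

/-! ### Averages over a design -/

section Design

variable {d N : ℕ} {G : Type*} [Group G] [TopologicalSpace G] [MeasurableSpace G]
  {μ : Measure G} {π : G →* Matrix.unitaryGroup (Fin d) ℂ}
  {𝒰 : Finset (Matrix.unitaryGroup (Fin d) ℂ)}

theorem rotate_mul (U V : Matrix.unitaryGroup (Fin d) ℂ)
    (ρ : Matrix (Fin N → Fin d) (Fin N → Fin d) ℂ) :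
    rotate (U * V) ρ = rotate U (rotate V ρ) := by
  simp only [rotate, Submonoid.coe_mul, tensorPow_mul, Matrix.conjTranspose_mul, mul_assoc]

theorem IsGeneralisedDesign.nonempty [IsProbabilityMeasure μ] (h : IsGeneralisedDesign N π μ 𝒰)
    (hd : d ≠ 0) : 𝒰.Nonempty := by
  rw [Finset.nonempty_iff_ne_empty]
  rintro rfl
  -- the average of the identity over no gates is `0`, while its integral is `1`
  let i : Fin N → Fin d := fun _ => ⟨0, Nat.pos_of_ne_zero hd⟩
  have h1 (U : Matrix.unitaryGroup (Fin d) ℂ) : tensorPow N (U : Matrix (Fin d) (Fin d) ℂ) * 1 *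
      (tensorPow N (U : Matrix (Fin d) (Fin d) ℂ)).conjTranspose = 1 := by
    rw [mul_one]
    exact mul_eq_one_comm.mp (conjTranspose_tensorPow_mul_self U)
  have := h.average_eq 1 i i
  simp only [h1] at this
  simp at this

omit [MeasurableSpace G] in
theorem continuous_rotate_apply (hπ : Continuous π)
    (ρ : Matrix (Fin N → Fin d) (Fin N → Fin d) ℂ) (i j : Fin N → Fin d) :
    Continuous fun g => rotate (π g) ρ i j := by
  have h (a b : Fin d) : Continuous fun g => ((π g : Matrix (Fin d) (Fin d) ℂ)) a b :=
    (continuous_subtype_val.comp hπ).matrix_elem a b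
  simp only [rotate_apply]
  fun_prop

/-- Left invariance of the Haar measure makes the average of a state over a design invariant. -/
theorem IsGeneralisedDesign.rotate_average [IsTopologicalGroup G] [CompactSpace G] [BorelSpace G]
    [μ.IsHaarMeasure] (h : IsGeneralisedDesign N π μ 𝒰)
    (ρ : Matrix (Fin N → Fin d) (Fin N → Fin d) ℂ) {U : Matrix.unitaryGroup (Fin d) ℂ}
    (hU : U ∈ 𝒰) :
    rotate U ((𝒰.card : ℂ)⁻¹ • ∑ V ∈ 𝒰, rotate V ρ) = (𝒰.card : ℂ)⁻¹ • ∑ V ∈ 𝒰, rotate V ρ := by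
  obtain ⟨g₀, rfl⟩ := h.mem_range U hU
  have hint (i j : Fin N → Fin d) : Integrable (fun g => rotate (π g) ρ i j) μ :=
    (continuous_rotate_apply h.continuous_rep ρ i j).integrable_of_hasCompactSupport
      (HasCompactSupport.of_compactSpace _)
  have havg (i j : Fin N → Fin d) : ((𝒰.card : ℂ)⁻¹ • ∑ V ∈ 𝒰, rotate V ρ) i j =
      ∫ g, rotate (π g) ρ i j ∂μ := by
    rw [Matrix.smul_apply, Matrix.sum_apply, smul_eq_mul]
    exact h.average_eq ρ i j
  ext i j
  rw [havg i j, ← integral_mul_left_eq_self _ g₀, rotate_apply]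
  simp only [map_mul, rotate_mul]
  simp_rw [rotate_apply (π g₀) (rotate _ ρ), havg]
  rw [integral_finsetSum]
  · refine Finset.sum_congr rfl fun k _ => ?_
    rw [integral_finsetSum]
    · refine Finset.sum_congr rfl fun l _ => ?_
      rw [integral_mul_const]
    · exact fun l _ => (hint k l).mul_const _
  · exact fun k _ => integrable_finsetSum _ fun l _ => (hint k l).mul_const _

end Design

/-! ### Guessing the gate -/

section Ensemble

variable {d N : ℕ} {𝒰 : Finset (Matrix.unitaryGroup (Fin d) ℂ)}
  {ψ : EuclideanSpace ℂ (Fin N → Fin d)}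

theorem pureState_eq_vecMulVec {κ : Type*} (χ : EuclideanSpace ℂ κ) :
    pureState χ = Matrix.vecMulVec χ.ofLp (star χ.ofLp) := rfl

theorem isDensity_pureState {κ : Type*} [Fintype κ] {χ : EuclideanSpace ℂ κ} (hχ : ‖χ‖ = 1) :
    IsDensity (pureState χ) where
  posSemidef := Matrix.posSemidef_vecMulVec_self_star _
  trace_eq_one := by
    rw [pureState_eq_vecMulVec, Matrix.trace_vecMulVec, ← EuclideanSpace.inner_eq_star_dotProduct,
      inner_self_eq_norm_sq_to_K, hχ]
    simp

theorem rotatedState_eq_vecMulVec (U : Matrix.unitaryGroup (Fin d) ℂ) :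
    rotatedState ψ U = Matrix.vecMulVec
      ((tensorPow N (U : Matrix (Fin d) (Fin d) ℂ)).mulVec ψ.ofLp)
      (star ((tensorPow N (U : Matrix (Fin d) (Fin d) ℂ)).mulVec ψ.ofLp)) := by
  rw [rotatedState, pureState_eq_vecMulVec, Matrix.mul_vecMulVec, Matrix.vecMulVec_mul,
    Matrix.star_mulVec]

theorem isDensity_rotatedState (hψ : ‖ψ‖ = 1) (U : Matrix.unitaryGroup (Fin d) ℂ) :
    IsDensity (rotatedState ψ U) :=
  (isDensity_pureState hψ).rotate U

theorem rotatedState_mul_mul_rotatedState (U : Matrix.unitaryGroup (Fin d) ℂ)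
    (A : Matrix (Fin N → Fin d) (Fin N → Fin d) ℂ) :
    rotatedState ψ U * A * rotatedState ψ U =
      (A * rotatedState ψ U).trace • rotatedState ψ U := by
  rw [rotatedState_eq_vecMulVec, vecMulVec_mul_mul_vecMulVec]

theorem isDensity_averageState (hψ : ‖ψ‖ = 1) (hne : 𝒰.Nonempty) :
    IsDensity (averageState 𝒰 ψ) where
  posSemidef := by
    refine (Matrix.posSemidef_sum _ fun U _ => (isDensity_rotatedState hψ U).posSemidef).smul ?_
    rw [← Complex.ofReal_natCast, ← Complex.ofReal_inv]
    exact_mod_cast inv_nonneg.mpr (Nat.cast_nonneg (α := ℝ) _)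
  trace_eq_one := by
    have : (𝒰.card : ℂ) ≠ 0 := by exact_mod_cast hne.card_pos.ne'
    simp [averageState, Matrix.trace_smul, Matrix.trace_sum,
      (isDensity_rotatedState hψ _).trace_eq_one, this]

/-- If the average state is invariant under the gates in `𝒰`, so are all its functions, and they
have the same expectation in every state of the ensemble. -/
theorem trace_cfc_mul_rotatedState (hne : 𝒰.Nonempty)
    (hinv : ∀ U ∈ 𝒰, rotate U (averageState 𝒰 ψ) = averageState 𝒰 ψ) (f : ℝ → ℝ)
    {U : Matrix.unitaryGroup (Fin d) ℂ} (hU : U ∈ 𝒰) :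
    (cfc f (averageState 𝒰 ψ) * rotatedState ψ U).trace =
      (cfc f (averageState 𝒰 ψ) * averageState 𝒰 ψ).trace := by
  set ω := averageState 𝒰 ψ with hω
  have hbase (V) (hV : V ∈ 𝒰) :
      (cfc f ω * rotatedState ψ V).trace = (cfc f ω * pureState ψ).trace := by
    set T := tensorPow N (V : Matrix (Fin d) (Fin d) ℂ)
    have hTT : T.conjTranspose * T = 1 := conjTranspose_tensorPow_mul_self V
    have hc : Commute ω T := by
      have : T * ω * T.conjTranspose = ω := hinv V hV
      rw [commute_iff_eq]
      conv_lhs => rw [← this]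
      rw [mul_assoc, hTT, mul_one]
    have hcf := (hc.cfc_real f).eq
    calc (cfc f ω * (T * pureState ψ * T.conjTranspose)).trace
        = (T * (cfc f ω * pureState ψ) * T.conjTranspose).trace := by
          rw [← mul_assoc, ← mul_assoc, hcf, mul_assoc T]
      _ = _ := by rw [Matrix.trace_mul_comm, ← mul_assoc, hTT, one_mul]
  have hcard : (𝒰.card : ℂ) ≠ 0 := by exact_mod_cast hne.card_pos.ne'
  rw [hbase U hU]
  conv_rhs => enter [1, 2]; rw [hω, averageState]
  rw [Matrix.mul_smul, Matrix.mul_sum, Matrix.trace_smul, Matrix.trace_sum,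
    Finset.sum_congr rfl hbase, Finset.sum_const, nsmul_eq_mul, smul_eq_mul,
    inv_mul_cancel_left₀ hcard]

theorem ofReal_traceSqrt (hψ : ‖ψ‖ = 1) (hne : 𝒰.Nonempty) :
    (traceSqrt 𝒰 ψ : ℂ) = (cfc Real.sqrt (averageState 𝒰 ψ)).trace := by
  rw [traceSqrt, trace_cfc (isDensity_averageState hψ hne).posSemidef.1, ← Complex.ofReal_sum,
    Complex.ofReal_re]

theorem traceSqrt_eq_sum (hψ : ‖ψ‖ = 1) (hne : 𝒰.Nonempty) :
    traceSqrt 𝒰 ψ = ∑ i, √((isDensity_averageState hψ hne).posSemidef.1.eigenvalues i) := by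
  rw [traceSqrt, trace_cfc (isDensity_averageState hψ hne).posSemidef.1, ← Complex.ofReal_sum,
    Complex.ofReal_re]

/-- `Ψ_U ≤ (Tr √⟨Ψ⟩) √⟨Ψ⟩`: the operator on the right is a feasible point of the semidefinite
program dual to optimal guessing. -/
theorem posSemidef_traceSqrt_smul_sub_rotatedState (hψ : ‖ψ‖ = 1) (hne : 𝒰.Nonempty)
    (hinv : ∀ U ∈ 𝒰, rotate U (averageState 𝒰 ψ) = averageState 𝒰 ψ)
    {U : Matrix.unitaryGroup (Fin d) ℂ} (hU : U ∈ 𝒰) :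
    ((traceSqrt 𝒰 ψ : ℂ) • cfc Real.sqrt (averageState 𝒰 ψ) - rotatedState ψ U).PosSemidef := by
  rw [ofReal_traceSqrt hψ hne, rotatedState_eq_vecMulVec]
  refine posSemidef_trace_sqrt_smul_sqrt_sub (isDensity_averageState hψ hne).posSemidef _
    fun f => ?_
  rw [← rotatedState_eq_vecMulVec]
  exact trace_cfc_mul_rotatedState hne hinv f hU

theorem successProb_le (hψ : ‖ψ‖ = 1) (hne : 𝒰.Nonempty)
    (hinv : ∀ U ∈ 𝒰, rotate U (averageState 𝒰 ψ) = averageState 𝒰 ψ)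
    {P : 𝒰 → Matrix (Fin N → Fin d) (Fin N → Fin d) ℂ} (hP : IsPOVM P) :
    successProb 𝒰 ψ P ≤ traceSqrt 𝒰 ψ ^ 2 / 𝒰.card := by
  set Γ := (traceSqrt 𝒰 ψ : ℂ) • cfc Real.sqrt (averageState 𝒰 ψ)
  have hΓ : Γ.trace.re = traceSqrt 𝒰 ψ ^ 2 := by
    rw [Matrix.trace_smul, ← ofReal_traceSqrt hψ hne, smul_eq_mul, ← Complex.ofReal_mul,
      Complex.ofReal_re, sq]
  have hle (U : 𝒰) : (P U * rotatedState ψ U.1).trace.re ≤ (P U * Γ).trace.re := by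
    have := re_trace_mul_nonneg (hP.posSemidef U)
      (posSemidef_traceSqrt_smul_sub_rotatedState hψ hne hinv U.2)
    rw [mul_sub, Matrix.trace_sub, Complex.sub_re] at this
    linarith
  have hsum : ∑ U, (P U * Γ).trace.re = traceSqrt 𝒰 ψ ^ 2 := by
    rw [← Complex.re_sum, ← Matrix.trace_sum, ← Finset.sum_mul, hP.sum_eq_one, one_mul, hΓ]
  rw [successProb, inv_mul_eq_div, ← hsum]
  exact div_le_div_of_nonneg_right (Finset.sum_le_sum fun U _ => hle U) (Nat.cast_nonneg _)

theorem posSemidef_sqrtMeasurement (hψ : ‖ψ‖ = 1) (U : 𝒰) :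
    (sqrtMeasurement 𝒰 ψ U).PosSemidef := by
  have h := (isDensity_rotatedState hψ U.1).posSemidef.mul_mul_conjTranspose_same
    (cfc (fun x : ℝ => (Real.sqrt x)⁻¹) (averageState 𝒰 ψ))
  rw [(isHermitian_cfc _ _).eq] at h
  refine h.smul ?_
  rw [← Complex.ofReal_natCast, ← Complex.ofReal_inv]
  exact_mod_cast inv_nonneg.mpr (Nat.cast_nonneg (α := ℝ) _)

/-- The elements of the square-root measurement sum up to the support projection of `⟨Ψ⟩`. -/
theorem posSemidef_one_sub_sum_sqrtMeasurement (hψ : ‖ψ‖ = 1) (hne : 𝒰.Nonempty) :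
    (1 - ∑ U, sqrtMeasurement 𝒰 ψ U).PosSemidef := by
  have hω := (isDensity_averageState hψ hne).posSemidef
  have hsum : ∑ U, sqrtMeasurement 𝒰 ψ U =
      cfc (fun x : ℝ => (√x)⁻¹) (averageState 𝒰 ψ) * averageState 𝒰 ψ *
        cfc (fun x : ℝ => (√x)⁻¹) (averageState 𝒰 ψ) := by
    simp only [sqrtMeasurement]
    rw [← Finset.smul_sum, ← Finset.sum_mul, ← Finset.mul_sum,
      Finset.sum_coe_sort 𝒰 (fun U => rotatedState ψ U)]
    conv_rhs => enter [1, 2]; rw [averageState]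
    rw [Matrix.mul_smul, Matrix.smul_mul]
  rw [hsum, cfc_mul_self hω.1, cfc_mul_cfc, ← cfc_one ℝ (averageState 𝒰 ψ) hω.1.isSelfAdjoint,
    ← cfc_sub _ _ _ (Matrix.finite_real_spectrum.continuousOn _)
      (Matrix.finite_real_spectrum.continuousOn _)]
  refine posSemidef_cfc hω.1 fun i => ?_
  rcases (hω.eigenvalues_nonneg i).eq_or_lt with h | h
  · simp [← h]
  · have h1 := Real.mul_self_sqrt h.le
    have h2 : √(hω.1.eigenvalues i) ≠ 0 := by positivity
    have : (√(hω.1.eigenvalues i))⁻¹ * hω.1.eigenvalues i * (√(hω.1.eigenvalues i))⁻¹ = 1 := by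
      conv_lhs => enter [1, 2]; rw [← h1]
      field_simp
    simp [this]

theorem successProb_sqrtMeasurement (hψ : ‖ψ‖ = 1) (hne : 𝒰.Nonempty)
    (hinv : ∀ U ∈ 𝒰, rotate U (averageState 𝒰 ψ) = averageState 𝒰 ψ) :
    successProb 𝒰 ψ (sqrtMeasurement 𝒰 ψ) = traceSqrt 𝒰 ψ ^ 2 / 𝒰.card := by
  have hω := (isDensity_averageState hψ hne).posSemidef
  have hcard : (𝒰.card : ℝ) ≠ 0 := by exact_mod_cast hne.card_pos.ne'
  set R := cfc (fun x : ℝ => (√x)⁻¹) (averageState 𝒰 ψ) with hR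
  have hT (U : 𝒰) : (R * rotatedState ψ U.1).trace = traceSqrt 𝒰 ψ := by
    rw [hR, trace_cfc_mul_rotatedState hne hinv _ U.2, cfc_mul_self hω.1, ofReal_traceSqrt hψ hne]
    congr 1
    refine cfc_congr_nonneg hω fun x _ => ?_
    rw [inv_mul_eq_div, Real.div_sqrt]
  have hU (U : 𝒰) : (sqrtMeasurement 𝒰 ψ U * rotatedState ψ U.1).trace.re =
      (𝒰.card : ℝ)⁻¹ * traceSqrt 𝒰 ψ ^ 2 := by
    have h : R * rotatedState ψ U.1 * R * rotatedState ψ U.1 =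
        (traceSqrt 𝒰 ψ : ℂ) • (R * rotatedState ψ U.1) := by
      rw [mul_assoc R, mul_assoc R, rotatedState_mul_mul_rotatedState, hT, Matrix.mul_smul]
    rw [sqrtMeasurement, ← hR, Matrix.smul_mul, h, Matrix.trace_smul, Matrix.trace_smul, hT,
      smul_eq_mul, smul_eq_mul, ← Complex.ofReal_natCast, ← Complex.ofReal_inv,
      ← Complex.ofReal_mul, ← Complex.ofReal_mul, Complex.ofReal_re, sq]
  simp only [successProb, hU, Finset.sum_const, Finset.card_univ, Fintype.card_coe, nsmul_eq_mul]
  field_simp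

/-- The square-root measurement is completed by giving the kernel of `⟨Ψ⟩` to any one outcome. -/
theorem guessProb_eq (hψ : ‖ψ‖ = 1) (hne : 𝒰.Nonempty)
    (hinv : ∀ U ∈ 𝒰, rotate U (averageState 𝒰 ψ) = averageState 𝒰 ψ) :
    guessProb 𝒰 ψ = traceSqrt 𝒰 ψ ^ 2 / 𝒰.card := by
  have hex := hne
  obtain ⟨U₀, hU₀⟩ := hex
  set E := 1 - ∑ U, sqrtMeasurement 𝒰 ψ U with hE
  have hEp : E.PosSemidef := posSemidef_one_sub_sum_sqrtMeasurement hψ hne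
  set P : 𝒰 → Matrix (Fin N → Fin d) (Fin N → Fin d) ℂ :=
    fun U => sqrtMeasurement 𝒰 ψ U + if U = ⟨U₀, hU₀⟩ then E else 0 with hPdef
  have hP : IsPOVM P := by
    refine ⟨fun U => (posSemidef_sqrtMeasurement hψ U).add ?_, ?_⟩
    · split_ifs
      exacts [hEp, Matrix.PosSemidef.zero]
    · simp [hPdef, Finset.sum_add_distrib, hE]
  have hge : traceSqrt 𝒰 ψ ^ 2 / 𝒰.card ≤ successProb 𝒰 ψ P := by
    rw [← successProb_sqrtMeasurement hψ hne hinv, successProb, successProb]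
    refine mul_le_mul_of_nonneg_left (Finset.sum_le_sum fun U _ => ?_) (by positivity)
    rw [hPdef, add_mul, Matrix.trace_add, Complex.add_re]
    refine le_add_of_nonneg_right (re_trace_mul_nonneg ?_ (isDensity_rotatedState hψ _).posSemidef)
    split_ifs
    exacts [hEp, Matrix.PosSemidef.zero]
  have heq := le_antisymm (successProb_le hψ hne hinv hP) hge
  refine IsGreatest.csSup_eq ⟨⟨P, hP, heq.symm⟩, ?_⟩
  rintro _ ⟨P', hP', rfl⟩
  exact successProb_le hψ hne hinv hP'

/-- When `Tr √⟨Ψ⟩ = 1`, the positive operators `√⟨Ψ⟩ - Ψ_U` are traceless, so they vanish. -/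
theorem rotatedState_eq_of_traceSqrt_eq_one (hψ : ‖ψ‖ = 1) (hne : 𝒰.Nonempty)
    (hinv : ∀ U ∈ 𝒰, rotate U (averageState 𝒰 ψ) = averageState 𝒰 ψ)
    (h : traceSqrt 𝒰 ψ = 1) {U : Matrix.unitaryGroup (Fin d) ℂ} (hU : U ∈ 𝒰) :
    rotatedState ψ U = cfc Real.sqrt (averageState 𝒰 ψ) := by
  have hp := posSemidef_traceSqrt_smul_sub_rotatedState hψ hne hinv hU
  have ht := ofReal_traceSqrt hψ hne
  rw [h, Complex.ofReal_one] at ht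
  rw [h, Complex.ofReal_one, one_smul] at hp
  refine (sub_eq_zero.mp (hp.trace_eq_zero_iff.mp ?_)).symm
  rw [Matrix.trace_sub, ← ht, (isDensity_rotatedState hψ U).trace_eq_one, sub_self]

end Ensemble

/-! ### The singlet -/

section Singlet

variable {d : ℕ}

/-- Leibniz' formula. -/
theorem sum_prod_mul_leviCivita (A : Matrix (Fin d) (Fin d) ℂ) :
    ∑ m : Fin d → Fin d, (∏ a, A a (m a)) * leviCivita m = A.det := by
  simp only [leviCivita, Finset.mul_sum]
  rw [Finset.sum_comm, ← Matrix.det_transpose, Matrix.det_apply']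
  refine Finset.sum_congr rfl fun σ _ => ?_
  simp [mul_comm]

theorem leviCivita_eq_det (k : Fin d → Fin d) :
    leviCivita k = ((1 : Matrix (Fin d) (Fin d) ℂ).submatrix k id).det := by
  rw [← sum_prod_mul_leviCivita]
  simp [Matrix.one_apply, Finset.prod_ite_zero, ← funext_iff]

theorem leviCivita_perm (σ : Equiv.Perm (Fin d)) :
    leviCivita (σ : Fin d → Fin d) = ((Equiv.Perm.sign σ : ℤ) : ℂ) := by
  rw [leviCivita_eq_det, Matrix.det_permute, Matrix.det_one, mul_one]

theorem sum_leviCivita_mul_star :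
    ∑ m : Fin d → Fin d, leviCivita m * star (leviCivita m) = (d ! : ℂ) := by
  have h (m : Fin d → Fin d) : leviCivita m * star (leviCivita m) =
      ∑ σ : Equiv.Perm (Fin d),
        if m = σ then ((Equiv.Perm.sign σ : ℤ) : ℂ) * star (leviCivita m) else 0 := by
    conv_lhs => rw [leviCivita, Finset.sum_mul]
    simp only [ite_mul, zero_mul]
    rfl
  simp only [h]
  rw [Finset.sum_comm]
  have h1 (σ : Equiv.Perm (Fin d)) :
      ((Equiv.Perm.sign σ : ℤ) : ℂ) * ((Equiv.Perm.sign σ : ℤ) : ℂ) = 1 := by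
    rw [← Int.cast_mul, ← Units.val_mul, Int.units_mul_self]; simp
  simp [leviCivita_perm, h1, Fintype.card_perm]

/-- The singlet spans a one-dimensional representation. -/
theorem sum_prod_mul_leviCivita_comp (U : Matrix (Fin d) (Fin d) ℂ) (k : Fin d → Fin d) :
    ∑ m : Fin d → Fin d, (∏ a, U (k a) (m a)) * leviCivita m = U.det * leviCivita k := by
  have h : U.submatrix k id = (1 : Matrix (Fin d) (Fin d) ℂ).submatrix k id * U := by
    ext i j
    simp [Matrix.mul_apply, Matrix.one_apply]
  rw [leviCivita_eq_det k, mul_comm, ← Matrix.det_mul, ← h, ← sum_prod_mul_leviCivita]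
  rfl

theorem prod_finProdFinEquiv {t : ℕ} (g : Fin (t * d) → ℂ) :
    ∏ x, g x = ∏ s, ∏ a, g (finProdFinEquiv (s, a)) := by
  rw [← Equiv.prod_comp finProdFinEquiv, Fintype.prod_prod_type]

/-- Sums over the configurations of `t` groups of `d` particles factorise. -/
theorem sum_prod_groups {t : ℕ} (F : Fin t → (Fin d → Fin d) → ℂ) :
    ∑ k : Fin (t * d) → Fin d, ∏ s, F s (fun a => k (finProdFinEquiv (s, a))) =
      ∏ s, ∑ m, F s m := by
  rw [Finset.prod_univ_sum, Fintype.piFinset_univ]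
  exact Fintype.sum_equiv ((Equiv.arrowCongr finProdFinEquiv.symm (Equiv.refl _)).trans
    (Equiv.curry _ _ _)) _ _ fun k => rfl

theorem tensorPow_mulVec_singletPow (t : ℕ) (U : Matrix (Fin d) (Fin d) ℂ) :
    (tensorPow (t * d) U).mulVec (singletPow d t).ofLp =
      U.det ^ t • (singletPow d t).ofLp := by
  ext k
  simp only [Matrix.mulVec, dotProduct, tensorPow, Matrix.of_apply, singletPow, Pi.smul_apply,
    smul_eq_mul, prod_finProdFinEquiv, ← Finset.prod_mul_distrib]
  rw [sum_prod_groups fun s m => (∏ a, U (k (finProdFinEquiv (s, a))) (m a)) *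
    ((√(d ! : ℝ) : ℂ)⁻¹ * leviCivita m)]
  have h (s : Fin t) : ∑ m : Fin d → Fin d, (∏ a, U (k (finProdFinEquiv (s, a))) (m a)) *
      ((√(d ! : ℝ) : ℂ)⁻¹ * leviCivita m) =
      U.det * ((√(d ! : ℝ) : ℂ)⁻¹ * leviCivita fun a => k (finProdFinEquiv (s, a))) := by
    simp only [mul_left_comm _ ((√(d ! : ℝ) : ℂ)⁻¹)]
    rw [← Finset.mul_sum, sum_prod_mul_leviCivita_comp]
  simp only [h]
  rw [Finset.prod_mul_distrib, Finset.prod_const, Finset.card_univ, Fintype.card_fin]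

theorem rotate_pureState_singletPow (t : ℕ) (U : Matrix.unitaryGroup (Fin d) ℂ) :
    rotate U (pureState (singletPow d t)) = pureState (singletPow d t) := by
  have hdet : (U : Matrix (Fin d) (Fin d) ℂ).det * star (U : Matrix (Fin d) (Fin d) ℂ).det = 1 := by
    have := congrArg Matrix.det (Unitary.coe_mul_star_self U)
    rwa [Matrix.det_mul, Unitary.coe_star, Matrix.star_eq_conjTranspose, Matrix.det_conjTranspose,
      Matrix.det_one] at this
  have h : rotate U (pureState (singletPow d t)) = rotatedState (singletPow d t) U := rfl
  rw [h, rotatedState_eq_vecMulVec, tensorPow_mulVec_singletPow, star_smul,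
    Matrix.smul_vecMulVec, Matrix.vecMulVec_smul, smul_smul, star_pow, ← mul_pow, hdet, one_pow,
    one_smul, pureState_eq_vecMulVec]

theorem norm_singletPow (d t : ℕ) : ‖singletPow d t‖ = 1 := by
  have hfac : (√(d ! : ℝ) : ℂ)⁻¹ * (√(d ! : ℝ) : ℂ)⁻¹ * (d ! : ℂ) = 1 := by
    have h0 : (0 : ℝ) < d ! := by exact_mod_cast d.factorial_pos
    have h1 : (√(d ! : ℝ) : ℂ) * (√(d ! : ℝ) : ℂ) = (d ! : ℂ) := by
      exact_mod_cast Real.mul_self_sqrt h0.le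
    have h2 : (d ! : ℂ) ≠ 0 := by exact_mod_cast d.factorial_ne_zero
    rw [← mul_inv, h1, inv_mul_cancel₀ h2]
  have h : ((‖singletPow d t‖ ^ 2 : ℝ) : ℂ) = 1 := by
    have h1 := inner_self_eq_norm_sq_to_K (𝕜 := ℂ) (singletPow d t)
    rw [EuclideanSpace.inner_eq_star_dotProduct] at h1
    push_cast
    refine h1.symm.trans ?_
    simp only [dotProduct, singletPow, Pi.star_apply, star_prod, ← Finset.prod_mul_distrib]
    rw [sum_prod_groups fun _ m => (√(d ! : ℝ) : ℂ)⁻¹ * leviCivita m *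
      star ((√(d ! : ℝ) : ℂ)⁻¹ * leviCivita m)]
    refine Finset.prod_eq_one fun _ _ => ?_
    rw [← hfac, ← sum_leviCivita_mul_star, Finset.mul_sum]
    refine Finset.sum_congr rfl fun m _ => ?_
    have : star (√(d ! : ℝ) : ℂ)⁻¹ = (√(d ! : ℝ) : ℂ)⁻¹ := by
      rw [← Complex.ofReal_inv]; exact Complex.conj_ofReal _
    rw [star_mul, this]
    ring
  have h2 : ‖singletPow d t‖ ^ 2 = 1 := by exact_mod_cast h
  exact (pow_eq_one_iff_of_nonneg (norm_nonneg _) two_ne_zero).mp h2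

end Singlet

end CausalIntermediary

open CausalIntermediary
theorem mainTheorem6 {d N : ℕ} (hd : 2 ≤ d) (hN : 1 ≤ N)
    {G : Type*} [Group G] [TopologicalSpace G] [IsTopologicalGroup G] [CompactSpace G]
    [MeasurableSpace G] [BorelSpace G]
    (μ : Measure G) [μ.IsHaarMeasure] [IsProbabilityMeasure μ]
    (π : G →* Matrix.unitaryGroup (Fin d) ℂ)
    (𝒰 : Finset (Matrix.unitaryGroup (Fin d) ℂ))
    (h𝒰 : IsGeneralisedDesign N π μ 𝒰) :
    -- the complementarity relation, for every input state and every measurement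
    (∀ ψ : EuclideanSpace ℂ (Fin N → Fin d), ‖ψ‖ = 1 →
      ∀ P : Fin 2 → Matrix (Fin N → Fin d × Fin d) (Fin N → Fin d × Fin d) ℂ, IsPOVM P →
        1 / (2 * (d : ℝ) ^ N) *
            (1 + 1 / (2 * ((d : ℝ) ^ N - 1)) *
              ((guessProb 𝒰 ψ - 1 / (𝒰.card : ℝ)) / (1 / (𝒰.card : ℝ))) ^ 2)
          ≤ worstCaseError (𝒰 : Set (Matrix.unitaryGroup (Fin d) ℂ)) (pureState ψ) P) ∧
    -- the guessing bound, attained by the square-root measurement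
    (∀ ψ : EuclideanSpace ℂ (Fin N → Fin d), ‖ψ‖ = 1 →
      (∀ P : 𝒰 → Matrix (Fin N → Fin d) (Fin N → Fin d) ℂ, IsPOVM P →
        successProb 𝒰 ψ P ≤ traceSqrt 𝒰 ψ ^ 2 / 𝒰.card) ∧
      (∀ U, (sqrtMeasurement 𝒰 ψ U).PosSemidef) ∧
      (1 - ∑ U, sqrtMeasurement 𝒰 ψ U).PosSemidef ∧
      successProb 𝒰 ψ (sqrtMeasurement 𝒰 ψ) = traceSqrt 𝒰 ψ ^ 2 / 𝒰.card ∧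
      guessProb 𝒰 ψ = traceSqrt 𝒰 ψ ^ 2 / 𝒰.card) ∧
    -- no simple parallel strategy beats `1 / (2 d ^ N)`, whatever the set of unitaries
    (∀ 𝒱 : Set (Matrix.unitaryGroup (Fin d) ℂ), 𝒱.Nonempty →
      ∀ ρ : Matrix (Fin N → Fin d) (Fin N → Fin d) ℂ, IsDensity ρ →
      ∀ P : Fin 2 → Matrix (Fin N → Fin d × Fin d) (Fin N → Fin d × Fin d) ℂ, IsPOVM P →
        1 / (2 * (d : ℝ) ^ N) ≤ worstCaseError 𝒱 ρ P) ∧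
    -- the value `1 / (2 d ^ N)` is attained exactly when `p_guess` is the random guess probability
    (∀ ψ : EuclideanSpace ℂ (Fin N → Fin d), ‖ψ‖ = 1 →
      (guessProb 𝒰 ψ = 1 / (𝒰.card : ℝ) ↔
        ∃ P : Fin 2 → Matrix (Fin N → Fin d × Fin d) (Fin N → Fin d × Fin d) ℂ, IsPOVM P ∧
          worstCaseError (𝒰 : Set (Matrix.unitaryGroup (Fin d) ℂ)) (pureState ψ) P =
            1 / (2 * (d : ℝ) ^ N))) ∧
    -- the singlet strategy attains it, for arbitrary unitary gates
    (∀ t : ℕ, 1 ≤ t →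
      ‖singletPow d t‖ = 1 ∧
      ∃ P : Fin 2 → Matrix (Fin (t * d) → Fin d × Fin d) (Fin (t * d) → Fin d × Fin d) ℂ,
        IsPOVM P ∧
        (∀ U₁ U₂ : Matrix.unitaryGroup (Fin d) ℂ,
          errorProb (pureState (singletPow d t)) P U₁ U₂ = 1 / (2 * (d : ℝ) ^ (t * d))) ∧
        worstCaseError Set.univ (pureState (singletPow d t)) P =
          1 / (2 * (d : ℝ) ^ (t * d))) := by
  have hd0 : d ≠ 0 := by omega
  have hne := h𝒰.nonempty hd0
  have hinv (ψ : EuclideanSpace ℂ (Fin N → Fin d)) :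
      ∀ U ∈ 𝒰, rotate U (averageState 𝒰 ψ) = averageState 𝒰 ψ :=
    fun U hU => h𝒰.rotate_average (pureState ψ) hU
  have hcard : (0 : ℝ) < 𝒰.card := by exact_mod_cast hne.card_pos
  have hcardκ : 1 < Fintype.card (Fin N → Fin d) := by
    rw [Fintype.card_fun, Fintype.card_fin, Fintype.card_fin]
    exact Nat.one_lt_pow (by omega) (by omega)
  have hD : (1 : ℝ) < (d : ℝ) ^ N := one_lt_pow₀ (by exact_mod_cast hd) (by omega)
  have compl : ∀ ψ : EuclideanSpace ℂ (Fin N → Fin d), ‖ψ‖ = 1 →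
      ∀ P : Fin 2 → Matrix (Fin N → Fin d × Fin d) (Fin N → Fin d × Fin d) ℂ, IsPOVM P →
        1 / (2 * (d : ℝ) ^ N) *
            (1 + 1 / (2 * ((d : ℝ) ^ N - 1)) *
              ((guessProb 𝒰 ψ - 1 / (𝒰.card : ℝ)) / (1 / (𝒰.card : ℝ))) ^ 2)
          ≤ worstCaseError (𝒰 : Set (Matrix.unitaryGroup (Fin d) ℂ)) (pureState ψ) P := by
    intro ψ hψ P hP
    have hω := isDensity_averageState hψ hne
    have h1 := one_add_sq_le_sum_min hω.posSemidef.eigenvalues_nonneg hω.sum_eigenvalues hcardκ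
    have h2 := le_worstCaseError_average hd0 hne (isDensity_pureState hψ) hP rfl hω.posSemidef.1
    -- the complementarity term in terms of the spectrum of `⟨Ψ⟩`
    have hg : (guessProb 𝒰 ψ - 1 / (𝒰.card : ℝ)) / (1 / (𝒰.card : ℝ)) =
        traceSqrt 𝒰 ψ ^ 2 - 1 := by
      rw [guessProb_eq hψ hne (hinv ψ)]
      field_simp
    have hc : (Fintype.card (Fin N → Fin d) : ℝ) = (d : ℝ) ^ N := by simp
    rw [hg, traceSqrt_eq_sum hψ hne]
    rw [hc] at h1
    exact (mul_le_mul_of_nonneg_left h1 (by positivity)).trans h2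
  refine ⟨compl, ?_, ?_, ?_, ?_⟩
  · intro ψ hψ
    exact ⟨fun P hP => successProb_le hψ hne (hinv ψ) hP, posSemidef_sqrtMeasurement hψ,
      posSemidef_one_sub_sum_sqrtMeasurement hψ hne,
      successProb_sqrtMeasurement hψ hne (hinv ψ), guessProb_eq hψ hne (hinv ψ)⟩
  · intro 𝒱 h𝒱 ρ hρ P hP
    exact le_worstCaseError hd0 h𝒱 hρ hP
  · intro ψ hψ
    constructor
    · intro hg
      have hT : traceSqrt 𝒰 ψ = 1 := by
        rw [guessProb_eq hψ hne (hinv ψ), div_left_inj' hcard.ne'] at hg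
        have h0 : 0 ≤ traceSqrt 𝒰 ψ := by
          rw [traceSqrt_eq_sum hψ hne]
          exact Finset.sum_nonneg fun i _ => Real.sqrt_nonneg _
        exact (pow_eq_one_iff_of_nonneg h0 two_ne_zero).mp hg
      -- all the states of the ensemble coincide with `√⟨Ψ⟩`
      have heq (U) (hU : U ∈ 𝒰) := rotatedState_eq_of_traceSqrt_eq_one hψ hne (hinv ψ) hT hU
      obtain ⟨U₀, hU₀⟩ := hne
      have hΦ := isDensity_rotatedState hψ U₀
      have hΦΦ : rotatedState ψ U₀ * rotatedState ψ U₀ = rotatedState ψ U₀ := by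
        have := rotatedState_mul_mul_rotatedState (ψ := ψ) U₀ 1
        rwa [mul_one, one_mul, hΦ.trace_eq_one, one_smul] at this
      obtain ⟨P, hP, hP'⟩ := exists_isPOVM_errorProb_eq (𝒱 := (𝒰 : Set _)) (ρ := pureState ψ)
        hΦ hΦΦ fun U hU => (heq U hU).trans (heq U₀ hU₀).symm
      exact ⟨P, hP, worstCaseError_eq_of_forall ⟨U₀, hU₀⟩ hP'⟩
    · rintro ⟨P, hP, hw⟩
      have h := compl ψ hψ P hP
      set x := (guessProb 𝒰 ψ - 1 / (𝒰.card : ℝ)) / (1 / (𝒰.card : ℝ)) with hx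
      rw [hw, mul_le_iff_le_one_right (by positivity)] at h
      -- an optimal strategy leaves no room for the quadratic term, whose coefficient is positive
      have hx0 : x ^ 2 ≤ 0 := by
        have hpos : 0 < 1 / (2 * ((d : ℝ) ^ N - 1)) := by
          have : 0 < (d : ℝ) ^ N - 1 := by linarith
          positivity
        by_contra! hlt
        linarith [mul_pos hpos hlt]
      have hx1 : x = 0 := pow_eq_zero_iff two_ne_zero |>.mp (le_antisymm hx0 (sq_nonneg x))
      rw [hx, div_eq_zero_iff] at hx1
      rcases hx1 with h1 | h1
      · linarith
      · exact absurd h1 (by positivity)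
  · intro t _
    have hn := norm_singletPow d t
    have hΦΦ : pureState (singletPow d t) * pureState (singletPow d t) =
        pureState (singletPow d t) := by
      have := vecMulVec_mul_mul_vecMulVec 1 (singletPow d t).ofLp (star (singletPow d t).ofLp)
      rwa [← pureState_eq_vecMulVec, mul_one, one_mul, (isDensity_pureState hn).trace_eq_one,
        one_smul] at this
    obtain ⟨P, hP, hP'⟩ := exists_isPOVM_errorProb_eq (𝒱 := Set.univ)
      (isDensity_pureState hn) hΦΦ fun U _ => rotate_pureState_singletPow t U
    exact ⟨hn, P, hP, fun U₁ U₂ => hP' U₁ trivial U₂ trivial,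
      worstCaseError_eq_of_forall Set.univ_nonempty hP'⟩
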